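/- Let $m,n\ge 0$ and $M\ge 3$ be integers, $H\in\mathbb C^{m\times n}$, $v\in\mathbb C^m$, and let $s_i\in\{0,1,\dots,M-1\}$ for $i=1,\dots,n$. Let $x^*\in\mathbb C^n$ be the vector with entries $x_i^*=e^{2\pi s_i\mathbf i/M}$, put $X^*=x^*(x^*)^\dagger$ and $r=Hx^*+v$, and set $Q=H^\dagger H$, $c=-H^\dagger r$. Let $a_j=e^{\mathbf i(2j-1)\pi/M}$ for $j=0,\dots,M-1$. For $i=1,\dots,n$ let $t_i=s_i+1$ if $s_i<M-1$ and $t_i=0$ if $s_i=M-1$. Write $A\bullet B=\operatorname{Re}(\operatorname{Trace}(A^\dagger B))$, and consider the semidefinite program $$\text{(CSDP2)}\qquad \begin{array}{cl}\displaystyle\min_{x\in\mathbb C^n,\;X\in\mathbb C^{n\times n}} & Q\bullet X+2\operatorname{Re}(c^\dagger x)\\[4pt] \text{s.t.} & X_{ii}=1,\quad i=1,\dots,n,\\[2pt] & \operatorname{Re}(\overline{a_j}\,x_i)\le\cos(\pi/M),\quad i=1,\dots,n,\ j=0,\dots,M-1,\\[2pt] & \begin{bmatrix}1&x^\dagger\\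 x&X\end{bmatrix}\succeq 0.\end{array}$$ Then $(x^*,X^*)$ is an optimal solution of (CSDP2) if and only if there exist real numbers $\bar\lambda_i$, $\bar\mu_{i,s_i}\ge 0$ and $\bar\mu_{i,t_i}\ge 0$ $(i=1,\dots,n)$ such that $$[H^\dagger v]_i=\bar\lambda_i x_i^*+\frac{\bar\mu_{i,s_i}}2\,a_{s_i}+\frac{\bar\mu_{i,t_i}}2\,a_{t_i},\qquad i=1,\dots,n, \tag{1}$$ and $Q+\operatorname{Diag}(\bar\lambda)\succeq 0$. Furthermore, if there are such numbers $\bar\lambda_i\in\mathbb R$, $\bar\mu_{i,s_i}\ge0$, $\bar\mu_{i,t_i}\ge0$ satisfying (1) with $Q+\operatorname{Diag}(\bar\lambda)\succ 0$, then $(x^*,X^*)$ is the unique optimal solution of (CSDP2). -/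

import Mathlib

open scoped Matrix ComplexOrder

noncomputable section

namespace CSDP2

/-- `A • B = Re (Trace (A† B))`. -/
def bullet {n : ℕ} (A B : Matrix (Fin n) (Fin n) ℂ) : ℝ :=
  (Matrix.trace (Aᴴ * B)).re

/-- `a_j = exp (i θ_j)` with `θ_j = (2 j - 1) π / M`. -/
def a {M : ℕ} (j : Fin M) : ℂ :=
  Complex.exp ((((2 * (j : ℝ) - 1) * Real.pi / M : ℝ) : ℂ) * Complex.I)

/-- The constellation point `exp (2 π s i / M)`. -/
def symbol {M : ℕ} (s : Fin M) : ℂ :=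
  Complex.exp (((2 * Real.pi * (s : ℝ) / M : ℝ) : ℂ) * Complex.I)

/-- The cyclic successor: `s + 1` if `s < M - 1`, and `0` if `s = M - 1`. -/
def next {M : ℕ} (s : Fin M) : Fin M :=
  if h : (s : ℕ) + 1 < M then ⟨(s : ℕ) + 1, h⟩ else ⟨0, s.pos⟩

/-- The bordered matrix with rows `(1, x†)` and `(x, X)`. -/
def bordered {n : ℕ} (x : Fin n → ℂ) (X : Matrix (Fin n) (Fin n) ℂ) :
    Matrix (Unit ⊕ Fin n) (Unit ⊕ Fin n) ℂ :=
  Matrix.fromBlocks 1 (Matrix.replicateRow Unit (star x)) (Matrix.replicateCol Unit x) X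

/-- The feasible set of (CSDP2): pairs `(x, X)` with `X_ii = 1`,
`Re (a_j† x_i) ≤ cos (π / M)` for all `i`, `j`, and positive semidefinite bordered matrix. -/
def feasible (n M : ℕ) : Set ((Fin n → ℂ) × Matrix (Fin n) (Fin n) ℂ) :=
  {p | (∀ i, p.2 i i = 1) ∧
    (∀ (i : Fin n) (j : Fin M), (star (a j) * p.1 i).re ≤ Real.cos (Real.pi / M)) ∧
    (bordered p.1 p.2).PosSemidef}

/-- The objective `Q • X + 2 Re (c† x)`, where `Q = H† H` and `c = - H† r`. -/
def objective {m n : ℕ} (H : Matrix (Fin m) (Fin n) ℂ) (r : Fin m → ℂ)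
    (p : (Fin n → ℂ) × Matrix (Fin n) (Fin n) ℂ) : ℝ :=
  bullet (Hᴴ * H) p.2 + 2 * (star (-(Hᴴ *ᵥ r)) ⬝ᵥ p.1).re

/-- `p` is an optimal solution of (CSDP2) for the channel matrix `H`, the received vector `r`
and the constellation size `M`. -/
def IsOptimal {m n : ℕ} (M : ℕ) (H : Matrix (Fin m) (Fin n) ℂ) (r : Fin m → ℂ)
    (p : (Fin n → ℂ) × Matrix (Fin n) (Fin n) ℂ) : Prop :=
  p ∈ feasible n M ∧ ∀ q ∈ feasible n M, objective H r p ≤ objective H r q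

/-- The vector of transmitted symbols, `x*_i = exp (2 π s_i i / M)`. -/
def xStar {n M : ℕ} (s : Fin n → Fin M) : Fin n → ℂ := fun i => symbol (s i)

/-- The pair `(x*, X*)` with `X* = x* (x*)†`. -/
def solStar {n M : ℕ} (s : Fin n → Fin M) : (Fin n → ℂ) × Matrix (Fin n) (Fin n) ℂ :=
  (xStar s, Matrix.vecMulVec (xStar s) (star (xStar s)))

/-- `Q + Diag (lam)` with `Q = H† H`. -/
def shifted {m n : ℕ} (H : Matrix (Fin m) (Fin n) ℂ) (lam : Fin n → ℝ) :
    Matrix (Fin n) (Fin n) ℂ :=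
  Hᴴ * H + Matrix.diagonal (fun i => (lam i : ℂ))

/-- The multipliers `mu i (s i)`, `mu i (t i)` are nonnegative, where `t i = next (s i)`, and
`[H† v]_i = lam_i x*_i + (mu_{i, s_i} / 2) a_{s_i} + (mu_{i, t_i} / 2) a_{t_i}` for every `i`.
The values `mu i j` for other `j` play no role. -/
def Decomposes {m n M : ℕ} (H : Matrix (Fin m) (Fin n) ℂ) (v : Fin m → ℂ) (s : Fin n → Fin M)
    (lam : Fin n → ℝ) (mu : Fin n → Fin M → ℝ) : Prop :=
  ∀ i : Fin n, 0 ≤ mu i (s i) ∧ 0 ≤ mu i (next (s i)) ∧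
    (Hᴴ *ᵥ v) i = (lam i : ℂ) * xStar s i
      + ((mu i (s i) / 2 : ℝ) : ℂ) * a (s i)
      + ((mu i (next (s i)) / 2 : ℝ) : ℂ) * a (next (s i))

end CSDP2

end

/-!
With `u = x*`, set `V = X - x u† - u x† + u u† = (X - x x†) + (x - u)(x - u)†`. For a feasible point
this matrix (`lift`) is positive semidefinite, its diagonal is `V_ii = -2 Re (conj u_i (x - u)_i)`
because `X_ii = |u_i| = 1`, and the gap in the objective is
`Re tr (Q V) - 2 Re ((H† v)† (x - u))` (`objective_sub_objective_solStar`).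

Sufficiency is weak duality: inserting the decomposition of `H† v`, the `lam` terms turn into
`Diag lam • V` and the `mu` terms are nonnegative by the facet constraints active at `u`, so the gap
is at least `Re tr ((Q + Diag lam) V) ≥ 0` (`trace_shifted_mul_lift_le`). If `Q + Diag lam` is
positive definite, a zero gap forces `V = 0`, hence `x = u` and `X = u u†`.

Necessity needs no conic duality theorem, because the multipliers are explicit. As `M ≥ 3`, the two
active normals form a real basis of `ℂ` whose sum is a positive multiple of `u_i`; let `lam i`
(`multiplier`) be the largest real number leaving nonnegative coordinates in `H† v - lam u`. For
given `z` and `δ > 0`, the matrix `V = z z† + δ I` is, up to a small factor, the lift of a feasible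
point whose coordinates move along edges of the polygon (`exists_step_feasible`). With the better of
the two edges at each coordinate, optimality reads `Re tr ((Q + Diag lam) V) ≥ 0`
(`IsOptimal.trace_shifted_nonneg`), and `δ → 0` gives `z† (Q + Diag lam) z ≥ 0`.
-/

namespace CSDP2

/-! ### Positive semidefinite matrices and traces -/

theorem exists_conjTranspose_mul_self {n : ℕ} {S : Matrix (Fin n) (Fin n) ℂ}
    (hS : S.PosSemidef) : ∃ C : Matrix (Fin n) (Fin n) ℂ, S = Cᴴ * C := by
  open scoped MatrixOrder Matrix.Norms.L2Operator in
  exact CStarAlgebra.nonneg_iff_eq_star_mul_self.mp hS.nonneg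

theorem trace_mul_nonneg {n : ℕ} {S V : Matrix (Fin n) (Fin n) ℂ}
    (hS : S.PosSemidef) (hV : V.PosSemidef) : 0 ≤ (S * V).trace := by
  obtain ⟨C, rfl⟩ := exists_conjTranspose_mul_self hS
  rw [Matrix.mul_assoc, Matrix.trace_mul_comm]
  exact (hV.mul_mul_conjTranspose_same C).trace_nonneg

theorem eq_zero_of_trace_mul_eq_zero {n : ℕ} {S V : Matrix (Fin n) (Fin n) ℂ}
    (hS : S.PosDef) (hV : V.PosSemidef) (h : (S * V).trace = 0) : V = 0 := by
  have hu := hS.isUnit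
  obtain ⟨C, rfl⟩ := exists_conjTranspose_mul_self hS.posSemidef
  rw [Matrix.mul_assoc, Matrix.trace_mul_comm,
    (hV.mul_mul_conjTranspose_same C).trace_eq_zero_iff] at h
  have h1 : (Cᴴ * C) * V * (Cᴴ * C) = 0 := by
    calc (Cᴴ * C) * V * (Cᴴ * C) = Cᴴ * (C * V * Cᴴ) * C := by simp only [Matrix.mul_assoc]
      _ = 0 := by rw [h]; simp
  exact hu.mul_right_eq_zero.mp (hu.mul_left_eq_zero.mp h1)

theorem trace_mul_vecMulVec_star {n : ℕ} (Q : Matrix (Fin n) (Fin n) ℂ) (u w : Fin n → ℂ) :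
    (Q * Matrix.vecMulVec u (star w)).trace = star w ⬝ᵥ Q *ᵥ u := by
  rw [Matrix.mul_vecMulVec, Matrix.trace_vecMulVec, dotProduct_comm]

/-- The Cauchy–Schwarz inequality as a matrix inequality. -/
theorem posSemidef_smul_sub_vecMulVec {n : ℕ} {y : Fin n → ℂ} {c : ℝ}
    (hc : ∑ i, ‖y i‖ ^ 2 ≤ c) :
    ((c : ℂ) • (1 : Matrix (Fin n) (Fin n) ℂ) - Matrix.vecMulVec y (star y)).PosSemidef := by
  refine .of_dotProduct_mulVec_nonneg ?_ fun z => ?_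
  · ext i j
    by_cases hij : i = j <;>
      simp [Matrix.vecMulVec_apply, hij, eq_comm (a := j), mul_comm]
  · have h1 : star z ⬝ᵥ ((c : ℂ) • (1 : Matrix (Fin n) (Fin n) ℂ)
        - Matrix.vecMulVec y (star y)) *ᵥ z
        = ((c * ∑ i, ‖z i‖ ^ 2 - ‖∑ i, star (y i) * z i‖ ^ 2 : ℝ) : ℂ) := by
      have h2 : star z ⬝ᵥ z = ((∑ i, ‖z i‖ ^ 2 : ℝ) : ℂ) := by
        simp [dotProduct, Complex.conj_mul']
      have h3 : star z ⬝ᵥ y = star (star y ⬝ᵥ z) := by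
        rw [Matrix.star_dotProduct]
      have h4 : star y ⬝ᵥ z = ∑ i, star (y i) * z i := rfl
      rw [Matrix.sub_mulVec, dotProduct_sub, Matrix.smul_mulVec, Matrix.one_mulVec,
        dotProduct_smul, h2, Matrix.vecMulVec_mulVec, op_smul_eq_smul, dotProduct_smul, h3, h4,
        smul_eq_mul, smul_eq_mul, Complex.star_def, Complex.mul_conj']
      push_cast
      ring
    rw [h1, Complex.zero_le_real, sub_nonneg]
    have h5 : ‖∑ i, star (y i) * z i‖ ≤ ∑ i, ‖y i‖ * ‖z i‖ :=
      (norm_sum_le _ _).trans (Finset.sum_le_sum fun i _ => by simp)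
    calc ‖∑ i, star (y i) * z i‖ ^ 2 ≤ (∑ i, ‖y i‖ * ‖z i‖) ^ 2 := by gcongr
      _ ≤ (∑ i, ‖y i‖ ^ 2) * ∑ i, ‖z i‖ ^ 2 := Finset.sum_mul_sq_le_sq_mul_sq _ _ _
      _ ≤ c * ∑ i, ‖z i‖ ^ 2 := by gcongr

/-- Schur complement of the corner entry `1`. -/
theorem bordered_posSemidef_iff {n : ℕ} (x : Fin n → ℂ) (X : Matrix (Fin n) (Fin n) ℂ) :
    (bordered x X).PosSemidef ↔ (X - Matrix.vecMulVec x (star x)).PosSemidef := by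
  let _ : Invertible (1 : Matrix Unit Unit ℂ) := invertibleOne
  have h := Matrix.PosDef.fromBlocks₁₁ (A := (1 : Matrix Unit Unit ℂ))
    (Matrix.replicateRow Unit (star x)) X Matrix.PosDef.one
  rw [Matrix.conjTranspose_replicateRow, star_star, inv_one, Matrix.mul_one] at h
  rw [bordered, h, Matrix.vecMulVec_eq Unit]

theorem ofReal_two_mul_re (z : ℂ) : ((2 * z.re : ℝ) : ℂ) = z + star z := by
  rw [Complex.star_def, Complex.add_conj]

/-! ### The constellation -/

section Constellation

variable {M : ℕ}

theorem star_symbol_mul_self (s : Fin M) : star (symbol s) * symbol s = 1 := by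
  rw [symbol, Complex.star_def, Complex.conj_mul', Complex.norm_exp_ofReal_mul_I]
  simp

theorem star_a_mul_symbol_re (j s : Fin M) :
    (star (a j) * symbol s).re = Real.cos ((2 * ((s : ℝ) - j) + 1) * (Real.pi / M)) := by
  rw [symbol, a, Complex.star_def, ← Complex.exp_conj, ← Complex.exp_add, map_mul, Complex.conj_I,
    Complex.conj_ofReal, ← Complex.exp_ofReal_mul_I_re]
  congr 2
  push_cast
  ring

theorem a_self_eq (s : Fin M) :
    a s = symbol s * (Real.cos (Real.pi / M) - Real.sin (Real.pi / M) * Complex.I) := by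
  have h : (Real.cos (Real.pi / M) - Real.sin (Real.pi / M) * Complex.I : ℂ)
      = Complex.exp (((-(Real.pi / M) : ℝ) : ℂ) * Complex.I) := by
    rw [Complex.exp_mul_I, ← Complex.ofReal_cos, ← Complex.ofReal_sin, Real.cos_neg, Real.sin_neg]
    push_cast
    ring
  rw [h, symbol, a, ← Complex.exp_add]
  congr 1
  push_cast
  ring

theorem a_next_eq (s : Fin M) :
    a (next s) = symbol s * (Real.cos (Real.pi / M) + Real.sin (Real.pi / M) * Complex.I) := by
  have hM : (M : ℂ) ≠ 0 := by exact_mod_cast s.pos.ne'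
  have h : (Real.cos (Real.pi / M) + Real.sin (Real.pi / M) * Complex.I : ℂ)
      = Complex.exp (((Real.pi / M : ℝ) : ℂ) * Complex.I) := by
    rw [Complex.exp_mul_I, ← Complex.ofReal_cos, ← Complex.ofReal_sin]
  rw [h, symbol, a, ← Complex.exp_add]
  by_cases hs : (s : ℕ) + 1 < M
  · rw [next, dif_pos hs]
    congr 1
    push_cast
    ring
  -- For `s = M - 1` the two exponents differ by `2 π i`.
  · have hs' : ((s : ℕ) : ℂ) = M - 1 := by
      have h : (s : ℕ) + 1 = M := by omega
      exact eq_sub_of_add_eq (by exact_mod_cast h)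
    rw [next, dif_neg hs, ← Complex.exp_periodic]
    congr 1
    push_cast
    rw [hs']
    field_simp
    ring

theorem next_ne_self (hM : 2 ≤ M) (s : Fin M) : next s ≠ s := by
  intro h
  have h' := congrArg Fin.val h
  unfold next at h'
  split_ifs at h'
  · simp at h'
  · simp only at h'
    omega

theorem cos_lt_cos_of_lt_of_lt {φ θ : ℝ} (h0 : 0 ≤ φ) (h1 : φ < θ) (h2 : θ < 2 * Real.pi - φ) :
    Real.cos θ < Real.cos φ := by
  rcases le_total θ Real.pi with h | h
  · exact Real.cos_lt_cos_of_nonneg_of_le_pi h0 h h1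
  · rw [← Real.cos_two_pi_sub θ]
    exact Real.cos_lt_cos_of_nonneg_of_le_pi h0 (by linarith) (by linarith)

/-- At a constellation point only the two facets meeting there are active. -/
theorem star_a_mul_symbol_re_lt {j s : Fin M} (h1 : j ≠ s) (h2 : j ≠ next s) :
    (star (a j) * symbol s).re < Real.cos (Real.pi / M) := by
  have hM : (0 : ℝ) < M := by exact_mod_cast s.pos
  have hφ : 0 < Real.pi / M := div_pos Real.pi_pos hM
  have hMφ : M * (Real.pi / M) = Real.pi := by field_simp
  have h1' : (j : ℕ) ≠ s := fun h => h1 (Fin.ext h)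
  have h2' : (j : ℕ) ≠ next s := fun h => h2 (Fin.ext h)
  have hj := j.isLt
  have hs := s.isLt
  -- The angle is an odd multiple `k π / M`, and it suffices that `1 < |k| < 2 M - 1`.
  rw [star_a_mul_symbol_re]
  generalize Real.pi / M = φ at *
  rcases lt_or_gt_of_ne h1' with h | h
  · have hk1 : (1 : ℝ) ≤ (s : ℝ) - j := by
      have : (j : ℝ) + 1 ≤ s := by exact_mod_cast h
      linarith
    have hk2 : (s : ℝ) - j + 2 ≤ M := by
      have : (s : ℕ) + 2 ≤ M + j := by
        by_cases hs' : (s : ℕ) + 1 < M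
        · omega
        · simp only [next, dif_neg hs'] at h2'
          omega
      have : (s : ℝ) + 2 ≤ M + j := by exact_mod_cast this
      linarith
    exact cos_lt_cos_of_lt_of_lt hφ.le (by nlinarith) (by nlinarith)
  · have hk1 : (s : ℝ) - j + 2 ≤ 0 := by
      have : (s : ℕ) + 2 ≤ j := by
        have hs' : (s : ℕ) + 1 < M := by omega
        simp only [next, dif_pos hs'] at h2'
        omega
      have : (s : ℝ) + 2 ≤ j := by exact_mod_cast this
      linarith
    have hk2 : 1 ≤ (s : ℝ) - j + M := by
      have : (j : ℝ) + 1 ≤ s + M := by exact_mod_cast (by omega : (j : ℕ) + 1 ≤ s + M)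
      linarith
    rw [← Real.cos_neg]
    exact cos_lt_cos_of_lt_of_lt hφ.le (by nlinarith) (by nlinarith)

theorem star_a_self_mul_symbol_re (s : Fin M) :
    (star (a s) * symbol s).re = Real.cos (Real.pi / M) := by
  rw [star_a_mul_symbol_re]
  simp

/-- Real part of `conj (a s) * (symbol s * e)`, in the frame rotated by the symbol. -/
theorem star_a_self_mul_re (s : Fin M) (e : ℂ) : (star (a s) * (symbol s * e)).re
    = Real.cos (Real.pi / M) * e.re - Real.sin (Real.pi / M) * e.im := by
  have h : star (a s) * (symbol s * e) = (star (symbol s) * symbol s)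
      * ((Real.cos (Real.pi / M) + Real.sin (Real.pi / M) * Complex.I) * e) := by
    rw [a_self_eq]
    simp only [star_mul', star_sub, Complex.star_def, Complex.conj_ofReal, Complex.conj_I]
    ring
  rw [h, star_symbol_mul_self]
  generalize Real.cos _ = c, Real.sin _ = d
  simp

theorem star_a_next_mul_re (s : Fin M) (e : ℂ) : (star (a (next s)) * (symbol s * e)).re
    = Real.cos (Real.pi / M) * e.re + Real.sin (Real.pi / M) * e.im := by
  have h : star (a (next s)) * (symbol s * e) = (star (symbol s) * symbol s)
      * ((Real.cos (Real.pi / M) - Real.sin (Real.pi / M) * Complex.I) * e) := by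
    rw [a_next_eq]
    simp only [star_mul', star_add, Complex.star_def, Complex.conj_ofReal, Complex.conj_I]
    ring
  rw [h, star_symbol_mul_self]
  generalize Real.cos _ = c, Real.sin _ = d
  simp

theorem star_a_next_mul_symbol_re (s : Fin M) :
    (star (a (next s)) * symbol s).re = Real.cos (Real.pi / M) := by
  simpa using star_a_next_mul_re s 1

theorem star_a_mul_symbol_re_le (j s : Fin M) :
    (star (a j) * symbol s).re ≤ Real.cos (Real.pi / M) := by
  by_cases h1 : j = s
  · exact h1 ▸ (star_a_self_mul_symbol_re j).le
  by_cases h2 : j = next s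
  · exact h2 ▸ (star_a_next_mul_symbol_re s).le
  exact (star_a_mul_symbol_re_lt h1 h2).le

end Constellation

/-! ### The gap between a point and the transmitted solution -/

/-- The matrix `X - x u† - u x† + u u†`, which is `(x - u)(x - u)†` with `x x†` lifted to `X`. -/
noncomputable def lift {n : ℕ} (u : Fin n → ℂ) (p : (Fin n → ℂ) × Matrix (Fin n) (Fin n) ℂ) :
    Matrix (Fin n) (Fin n) ℂ :=
  p.2 - Matrix.vecMulVec p.1 (star u) - Matrix.vecMulVec u (star p.1)
    + Matrix.vecMulVec u (star u)

theorem lift_eq {n : ℕ} (u : Fin n → ℂ) (p : (Fin n → ℂ) × Matrix (Fin n) (Fin n) ℂ) :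
    lift u p = (p.2 - Matrix.vecMulVec p.1 (star p.1))
      + Matrix.vecMulVec (p.1 - u) (star (p.1 - u)) := by
  ext i j
  simp [lift, Matrix.vecMulVec_apply]
  ring

theorem lift_posSemidef {n M : ℕ} (u : Fin n → ℂ) {p : (Fin n → ℂ) × Matrix (Fin n) (Fin n) ℂ}
    (hp : p ∈ feasible n M) : (lift u p).PosSemidef := by
  rw [lift_eq]
  exact ((bordered_posSemidef_iff _ _).mp hp.2.2).add (Matrix.posSemidef_vecMulVec_self_star _)

/-- The unit diagonal of `X` makes the diagonal of the lift linear in `x`. -/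
theorem lift_diag {n M : ℕ} (s : Fin n → Fin M) {p : (Fin n → ℂ) × Matrix (Fin n) (Fin n) ℂ}
    (hp : ∀ i, p.2 i i = 1) (i : Fin n) : lift (xStar s) p i i
      = ((-2 * (star (xStar s i) * (p.1 - xStar s) i).re : ℝ) : ℂ) := by
  have h := star_symbol_mul_self (s i)
  rw [neg_mul, Complex.ofReal_neg, ofReal_two_mul_re]
  simp only [lift, Matrix.add_apply, Matrix.sub_apply, Matrix.vecMulVec_apply, hp, xStar,
    Pi.star_apply, Pi.sub_apply, star_mul', star_sub, star_star]
  linear_combination -h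

/-- The linear term `-2 Re ((Q u)† x)` of the objective is absorbed, with `X` and the constant, into
the lift at `u = x*`. -/
theorem objective_sub_objective_solStar {m n M : ℕ} (H : Matrix (Fin m) (Fin n) ℂ)
    (v : Fin m → ℂ) (s : Fin n → Fin M) (p : (Fin n → ℂ) × Matrix (Fin n) (Fin n) ℂ) :
    objective H (H *ᵥ xStar s + v) p - objective H (H *ᵥ xStar s + v) (solStar s)
      = (Hᴴ * H * lift (xStar s) p).trace.re
        - ∑ i, 2 * (star ((Hᴴ *ᵥ v) i) * (p.1 - xStar s) i).re := by
  have hQ : (Hᴴ * H)ᴴ = Hᴴ * H := by simp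
  have hsum : ∑ i, 2 * (star ((Hᴴ *ᵥ v) i) * (p.1 - xStar s) i).re
      = 2 * (star (Hᴴ *ᵥ v) ⬝ᵥ (p.1 - xStar s)).re := by
    rw [dotProduct, Complex.re_sum, Finset.mul_sum]
    rfl
  have hswap : ∀ u w : Fin n → ℂ, (star u ⬝ᵥ (Hᴴ * H) *ᵥ w).re
      = (star ((Hᴴ * H) *ᵥ u) ⬝ᵥ w).re := by
    intro u w
    rw [Matrix.star_mulVec, hQ, Matrix.dotProduct_mulVec]
  have hconj : ∀ u w : Fin n → ℂ, (star u ⬝ᵥ (Hᴴ * H) *ᵥ w).re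
      = (star w ⬝ᵥ (Hᴴ * H) *ᵥ u).re := by
    intro u w
    rw [hswap, Matrix.star_dotProduct, Complex.star_def, Complex.conj_re]
  rw [hsum]
  simp only [objective, bullet, solStar, lift, hQ, Matrix.mul_add, Matrix.mul_sub,
    Matrix.trace_add, Matrix.trace_sub, trace_mul_vecMulVec_star, Matrix.mulVec_add,
    Matrix.mulVec_mulVec, Complex.add_re, Complex.sub_re, star_neg, star_add, neg_dotProduct,
    add_dotProduct, dotProduct_sub, Complex.neg_re]
  rw [← hswap, ← hswap, hconj p.1 (xStar s)]
  ring

theorem trace_diagonal_mul_lift_re {n M : ℕ} (s : Fin n → Fin M) (lam : Fin n → ℝ)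
    {p : (Fin n → ℂ) × Matrix (Fin n) (Fin n) ℂ} (hp : ∀ i, p.2 i i = 1) :
    (Matrix.diagonal (fun i => (lam i : ℂ)) * lift (xStar s) p).trace.re
      = ∑ i, -2 * lam i * (star (xStar s i) * (p.1 - xStar s) i).re := by
  rw [Matrix.trace, Complex.re_sum]
  refine Finset.sum_congr rfl fun i _ => ?_
  rw [Matrix.diag_apply, Matrix.diagonal_mul, lift_diag s hp, ← Complex.ofReal_mul,
    Complex.ofReal_re]
  ring

/-! ### Sufficiency and uniqueness -/

theorem solStar_mem_feasible {n M : ℕ} (s : Fin n → Fin M) : solStar s ∈ feasible n M := by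
  refine ⟨fun i => ?_, fun i j => star_a_mul_symbol_re_le j (s i), ?_⟩
  · change xStar s i * star (xStar s i) = 1
    rw [mul_comm]
    exact star_symbol_mul_self (s i)
  · rw [bordered_posSemidef_iff, solStar, sub_self]
    exact .zero

/-- Weak duality: the multipliers bound the gap in the objective from below. The term in `lam`
enters the trace because the diagonal of the lift is linear in `x`. -/
theorem trace_shifted_mul_lift_le {m n M : ℕ} {H : Matrix (Fin m) (Fin n) ℂ}
    {v : Fin m → ℂ} {s : Fin n → Fin M} {lam : Fin n → ℝ} {mu : Fin n → Fin M → ℝ}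
    (hd : Decomposes H v s lam mu) {p : (Fin n → ℂ) × Matrix (Fin n) (Fin n) ℂ}
    (hp : p ∈ feasible n M) :
    (shifted H lam * lift (xStar s) p).trace.re
      ≤ objective H (H *ᵥ xStar s + v) p - objective H (H *ᵥ xStar s + v) (solStar s) := by
  rw [objective_sub_objective_solStar, shifted, Matrix.add_mul, Matrix.trace_add, Complex.add_re,
    trace_diagonal_mul_lift_re s lam hp.1,
    sub_eq_add_neg (Complex.re _) (Finset.sum _ _), ← Finset.sum_neg_distrib]
  refine add_le_add_right (Finset.sum_le_sum fun i _ => ?_) _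
  obtain ⟨h1, h2, h3⟩ := hd i
  -- The facet constraints at `s i` and `next (s i)` hold with equality at `x*`.
  have key : ∀ j : Fin M, (star (a j) * symbol (s i)).re = Real.cos (Real.pi / M) →
      (star (a j) * (p.1 - xStar s) i).re ≤ 0 := by
    intro j hj
    have := hp.2.1 i j
    rw [Pi.sub_apply, mul_sub, Complex.sub_re, xStar, hj]
    linarith
  have k1 := mul_nonneg h1 (neg_nonneg.mpr (key _ (star_a_self_mul_symbol_re (s i))))
  have k2 := mul_nonneg h2 (neg_nonneg.mpr (key _ (star_a_next_mul_symbol_re (s i))))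
  have h4 : (star ((Hᴴ *ᵥ v) i) * (p.1 - xStar s) i).re
      = lam i * (star (xStar s i) * (p.1 - xStar s) i).re
        + mu i (s i) / 2 * (star (a (s i)) * (p.1 - xStar s) i).re
        + mu i (next (s i)) / 2 * (star (a (next (s i))) * (p.1 - xStar s) i).re := by
    rw [h3]
    simp only [star_add, star_mul', Complex.star_def, Complex.conj_ofReal, add_mul, mul_assoc,
      Complex.add_re, Complex.re_ofReal_mul]
  rw [h4]
  linarith

theorem isOptimal_of_decomposes {m n M : ℕ} {H : Matrix (Fin m) (Fin n) ℂ}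
    {v : Fin m → ℂ} {s : Fin n → Fin M} {lam : Fin n → ℝ} {mu : Fin n → Fin M → ℝ}
    (hd : Decomposes H v s lam mu) (hS : (shifted H lam).PosSemidef) :
    IsOptimal M H (H *ᵥ xStar s + v) (solStar s) := by
  refine ⟨solStar_mem_feasible s, fun q hq => ?_⟩
  have h1 := trace_shifted_mul_lift_le hd hq
  have h2 := (Complex.nonneg_iff.mp (trace_mul_nonneg hS (lift_posSemidef (xStar s) hq))).1
  linarith

/-- A vanishing lift is the sum of the two positive semidefinite matrices `X - x x†` and
`(x - u)(x - u)†`, so both vanish. -/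
theorem eq_of_lift_eq_zero {n M : ℕ} {u : Fin n → ℂ}
    {p : (Fin n → ℂ) × Matrix (Fin n) (Fin n) ℂ} (hp : p ∈ feasible n M) (h : lift u p = 0) :
    p = (u, Matrix.vecMulVec u (star u)) := by
  have hW := (bordered_posSemidef_iff _ _).mp hp.2.2
  rw [lift_eq] at h
  have hx : p.1 = u := by
    funext i
    have hi := congrFun (congrFun h i) i
    rw [Matrix.add_apply, Matrix.vecMulVec_apply, Matrix.zero_apply] at hi
    have hnn : 0 ≤ (p.1 - u) i * star ((p.1 - u) i) := mul_star_self_nonneg _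
    have h0 := ((add_eq_zero_iff_of_nonneg hW.diag_nonneg hnn).mp hi).2
    exact sub_eq_zero.mp ((mul_eq_zero.mp h0).elim id star_eq_zero.mp)
  rw [hx, sub_self, Matrix.zero_vecMulVec, add_zero] at h
  exact Prod.ext hx (sub_eq_zero.mp h)

theorem eq_solStar_of_isOptimal {m n M : ℕ} {H : Matrix (Fin m) (Fin n) ℂ}
    {v : Fin m → ℂ} {s : Fin n → Fin M} {lam : Fin n → ℝ} {mu : Fin n → Fin M → ℝ}
    (hd : Decomposes H v s lam mu) (hS : (shifted H lam).PosDef)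
    {p : (Fin n → ℂ) × Matrix (Fin n) (Fin n) ℂ}
    (hp : IsOptimal M H (H *ᵥ xStar s + v) p) : p = solStar s := by
  have hV := lift_posSemidef (xStar s) hp.1
  have h1 := trace_shifted_mul_lift_le hd hp.1
  have h2 := Complex.nonneg_iff.mp (trace_mul_nonneg hS.posSemidef hV)
  have h3 := hp.2 _ (solStar_mem_feasible s)
  refine eq_of_lift_eq_zero hp.1 (eq_zero_of_trace_mul_eq_zero hS hV ?_)
  exact Complex.ext (le_antisymm (by simpa using h1.trans (by linarith)) h2.1) h2.2.symm

/-! ### Necessity -/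

/-- A direction along one of the two edges of the polygon at the symbol, in the frame where the
symbol is `1` and the facet normals are `c ∓ σ i`. The real part `-1/2` matches a unit diagonal entry
of the lift, and the edge is the one on which a linear functional with imaginary part `w` is
larger. -/
theorem exists_edge_direction {c σ w : ℝ} (hσ : 0 < σ) (hc : 0 ≤ c) : ∃ e : ℂ, e.re = -1 / 2 ∧
    c * e.re - σ * e.im ≤ 0 ∧ c * e.re + σ * e.im ≤ 0 ∧ 2 * (w * e.im) = c / σ * |w| := by
  rcases le_total 0 w with h | h
  · refine ⟨⟨-1 / 2, c / (2 * σ)⟩, rfl, ?_, ?_, ?_⟩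
    · have : σ * (c / (2 * σ)) = c / 2 := by field_simp
      simp only [this]; linarith
    · have : σ * (c / (2 * σ)) = c / 2 := by field_simp
      simp only [this]; linarith
    · rw [abs_of_nonneg h]; field_simp
  · refine ⟨⟨-1 / 2, -(c / (2 * σ))⟩, rfl, ?_, ?_, ?_⟩
    · have : σ * -(c / (2 * σ)) = -c / 2 := by field_simp
      simp only [this]; linarith
    · have : σ * -(c / (2 * σ)) = -c / 2 := by field_simp
      simp only [this]; linarith
    · rw [abs_of_nonpos h]; field_simp

/-- For small steps `ε`, a move from `x*` along `y` whose lift is `ε (P + δ I)` is feasible. The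
inactive facets are slack at `x*`, and `X - x x† = ε (P + δ I - ε y y†)`, in which `δ I` dominates
the quadratic term. -/
theorem exists_step_feasible {n M : ℕ} (s : Fin n → Fin M) {y : Fin n → ℂ}
    {P : Matrix (Fin n) (Fin n) ℂ} (hP : P.PosSemidef) {δ : ℝ} (hδ : 0 < δ)
    (hdiag : ∀ i, (P + (δ : ℂ) • (1 : Matrix (Fin n) (Fin n) ℂ)) i i
      = ((-2 * (star (xStar s i) * y i).re : ℝ) : ℂ))
    (h1 : ∀ i, (star (a (s i)) * y i).re ≤ 0)
    (h2 : ∀ i, (star (a (next (s i))) * y i).re ≤ 0) :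
    ∃ ε : ℝ, 0 < ε ∧ ∃ p ∈ feasible n M, p.1 - xStar s = (ε : ℂ) • y ∧
      lift (xStar s) p = (ε : ℂ) • (P + (δ : ℂ) • (1 : Matrix (Fin n) (Fin n) ℂ)) := by
  have hfacet : ∀ᶠ ε : ℝ in nhdsWithin 0 (Set.Ioi 0), ∀ (i : Fin n) (j : Fin M),
      (star (a j) * (xStar s i + ε * y i)).re ≤ Real.cos (Real.pi / M) := by
    refine Filter.eventually_all.mpr fun i => Filter.eventually_all.mpr fun j => ?_
    have hre : ∀ ε : ℝ, (star (a j) * (xStar s i + ε * y i)).re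
        = (star (a j) * symbol (s i)).re + ε * (star (a j) * y i).re := by
      intro ε
      rw [mul_add, Complex.add_re, mul_left_comm, Complex.re_ofReal_mul, xStar]
    by_cases hj : (star (a j) * y i).re ≤ 0
    · filter_upwards [self_mem_nhdsWithin] with ε hε
      rw [hre]
      have := mul_nonpos_of_nonneg_of_nonpos (le_of_lt hε) hj
      linarith [star_a_mul_symbol_re_le j (s i)]
    · have hlt := star_a_mul_symbol_re_lt (j := j) (s := s i)
        (fun h => hj (h ▸ h1 i)) (fun h => hj (h ▸ h2 i))
      have hcont : Continuous fun ε : ℝ => (star (a j) * (xStar s i + ε * y i)).re := by fun_prop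
      have := hcont.continuousAt.eventually_lt (x₀ := (0 : ℝ)) continuousAt_const
        (by simpa only [hre, zero_mul, add_zero] using hlt)
      exact (this.filter_mono nhdsWithin_le_nhds).mono fun ε h => h.le
  have hsmall : ∀ᶠ ε : ℝ in nhdsWithin 0 (Set.Ioi 0), ε * ∑ i, ‖y i‖ ^ 2 ≤ δ := by
    have hcont : Continuous fun ε : ℝ => ε * ∑ i, ‖y i‖ ^ 2 := by fun_prop
    have := hcont.continuousAt.eventually_lt (x₀ := (0 : ℝ)) continuousAt_const
      (by simpa only [zero_mul] using hδ)
    exact (this.filter_mono nhdsWithin_le_nhds).mono fun ε h => h.le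
  obtain ⟨ε, hε, hf, hs⟩ :=
    ((eventually_mem_nhdsWithin (a := (0 : ℝ)) (s := Set.Ioi 0)).and (hfacet.and hsmall)).exists
  have hε : 0 < ε := hε
  set V := P + (δ : ℂ) • (1 : Matrix (Fin n) (Fin n) ℂ) with hV
  set x : Fin n → ℂ := xStar s + (ε : ℂ) • y with hx
  have hxy : x - xStar s = (ε : ℂ) • y := by rw [hx, add_sub_cancel_left]
  have hlift : lift (xStar s) (x, (ε : ℂ) • V - Matrix.vecMulVec (x - xStar s)
      (star (x - xStar s)) + Matrix.vecMulVec x (star x)) = (ε : ℂ) • V := by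
    rw [lift_eq]; simp
  refine ⟨ε, hε, _, ⟨fun i => ?_, hf, ?_⟩, hxy, hlift⟩
  · have hsym := star_symbol_mul_self (s i)
    have hd := hdiag i
    rw [neg_mul, Complex.ofReal_neg, ofReal_two_mul_re] at hd
    rw [hxy]
    simp only [Matrix.add_apply, Matrix.sub_apply, Matrix.vecMulVec_apply, hd, hx, xStar,
      Matrix.smul_apply, Pi.star_apply, Pi.add_apply, Pi.smul_apply, star_mul', star_add,
      smul_eq_mul, Complex.star_def, Complex.conj_ofReal, Complex.conj_conj] at hsym ⊢
    linear_combination hsym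
  · have hsplit : (ε : ℂ) • V - Matrix.vecMulVec (x - xStar s) (star (x - xStar s))
        = (ε : ℂ) • P + (((ε * δ : ℝ) : ℂ) • (1 : Matrix (Fin n) (Fin n) ℂ)
          - Matrix.vecMulVec ((ε : ℂ) • y) (star ((ε : ℂ) • y))) := by
      rw [hxy, hV, smul_add, smul_smul, Complex.ofReal_mul, add_sub_assoc]
    rw [bordered_posSemidef_iff, add_sub_cancel_right, hsplit]
    refine (hP.smul (Complex.zero_le_real.mpr hε.le)).add (posSemidef_smul_sub_vecMulVec ?_)
    have : ∑ i, ‖((ε : ℂ) • y) i‖ ^ 2 = ε * (ε * ∑ i, ‖y i‖ ^ 2) := by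
      rw [← mul_assoc, Finset.mul_sum]
      refine Finset.sum_congr rfl fun i _ => ?_
      rw [Pi.smul_apply, norm_smul, Complex.norm_real, Real.norm_eq_abs, mul_pow, sq_abs, sq]
    rw [this]
    exact mul_le_mul_of_nonneg_left hs hε.le

/-- `[H† v]_i` in the frame rotated so that the symbol `x*_i` becomes `1`. -/
noncomputable def rotated {m n M : ℕ} (H : Matrix (Fin m) (Fin n) ℂ) (v : Fin m → ℂ)
    (s : Fin n → Fin M) (i : Fin n) : ℂ :=
  star (xStar s i) * (Hᴴ *ᵥ v) i

/-- For `M ≥ 3`, the largest `lam` for which `[H† v]_i - lam x*_i` is a nonnegative combination of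
the facet normals `a (s i)` and `a (next (s i))`. -/
noncomputable def multiplier {m n M : ℕ} (H : Matrix (Fin m) (Fin n) ℂ) (v : Fin m → ℂ)
    (s : Fin n → Fin M) (i : Fin n) : ℝ :=
  (rotated H v s i).re
    - Real.cos (Real.pi / M) / Real.sin (Real.pi / M) * |(rotated H v s i).im|

/-- In the rotated frame the facet normals are `c ∓ σ i`, and the smaller of the two coordinates of
`[H† v]_i` along them is absorbed into the multiple of the symbol `1 = (c - σ i + c + σ i) / (2 c)`,
so that one of `mu i (s i)`, `mu i (next (s i))` vanishes. -/
theorem exists_decomposes {m n M : ℕ} (hM : 2 ≤ M) (H : Matrix (Fin m) (Fin n) ℂ) (v : Fin m → ℂ)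
    (s : Fin n → Fin M) (hσ : 0 < Real.sin (Real.pi / M)) :
    ∃ mu : Fin n → Fin M → ℝ, Decomposes H v s (multiplier H v s) mu := by
  refine ⟨fun i j => if j = s i
      then (|(rotated H v s i).im| - (rotated H v s i).im) / Real.sin (Real.pi / M)
      else (|(rotated H v s i).im| + (rotated H v s i).im) / Real.sin (Real.pi / M), fun i => ?_⟩
  simp only [if_true, if_neg (next_ne_self hM (s i))]
  have hg : (Hᴴ *ᵥ v) i = symbol (s i) * rotated H v s i := by
    rw [rotated, ← mul_assoc, mul_comm (symbol _), xStar, star_symbol_mul_self, one_mul]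
  rw [a_self_eq, a_next_eq, hg, multiplier, xStar]
  clear hg
  generalize rotated H v s i = w at *
  refine ⟨div_nonneg (sub_nonneg.mpr (le_abs_self _)) hσ.le,
    div_nonneg (by linarith [neg_abs_le w.im]) hσ.le, ?_⟩
  generalize Real.sin _ = σ, Real.cos _ = c at *
  have hσ' : (σ : ℂ) ≠ 0 := Complex.ofReal_ne_zero.mpr hσ.ne'
  conv_lhs => rw [← Complex.re_add_im w]
  push_cast
  field_simp
  ring

/-- Optimality tested on the lift `z z† + δ I`: its diagonal is positive, so it is matched by moving
each `x_i` along an edge at `x*_i`. With the edge chosen to favour the objective, the linear term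
contributes exactly `multiplier H v s i` times the diagonal entry. -/
theorem IsOptimal.trace_shifted_nonneg {m n M : ℕ} {H : Matrix (Fin m) (Fin n) ℂ}
    {v : Fin m → ℂ} {s : Fin n → Fin M} (hσ : 0 < Real.sin (Real.pi / M))
    (hc : 0 ≤ Real.cos (Real.pi / M)) (hopt : IsOptimal M H (H *ᵥ xStar s + v) (solStar s))
    (z : Fin n → ℂ) {δ : ℝ} (hδ : 0 < δ) :
    0 ≤ (shifted H (multiplier H v s)
      * (Matrix.vecMulVec z (star z) + (δ : ℂ) • 1)).trace.re := by
  choose e he1 he2 he3 he4 using fun i => exists_edge_direction (w := (rotated H v s i).im) hσ hc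
  have hd0 : ∀ i, 0 ≤ ‖z i‖ ^ 2 + δ := fun i => by positivity
  have hdiag : ∀ i, (Matrix.vecMulVec z (star z) + (δ : ℂ) • (1 : Matrix (Fin n) (Fin n) ℂ)) i i
      = ((‖z i‖ ^ 2 + δ : ℝ) : ℂ) := by
    intro i
    simp [Matrix.vecMulVec_apply, Complex.mul_conj']
  set V := Matrix.vecMulVec z (star z) + (δ : ℂ) • (1 : Matrix (Fin n) (Fin n) ℂ) with hV
  let y : Fin n → ℂ := fun i => ((‖z i‖ ^ 2 + δ : ℝ) : ℂ) * (symbol (s i) * e i)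
  have hy : ∀ b i, (b * y i).re = (‖z i‖ ^ 2 + δ) * (b * (symbol (s i) * e i)).re := by
    intro b i
    rw [mul_left_comm, Complex.re_ofReal_mul]
  obtain ⟨ε, hε, p, hp, hpy, hpV⟩ := exists_step_feasible s (y := y)
    (Matrix.posSemidef_vecMulVec_self_star z) hδ
    (fun i => by
      rw [← hV, hdiag, hy, xStar, ← mul_assoc (star _), star_symbol_mul_self, one_mul, he1]
      congr 1
      ring)
    (fun i => by
      rw [hy, star_a_self_mul_re]
      exact mul_nonpos_of_nonneg_of_nonpos (hd0 i) (he2 i))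
    (fun i => by
      rw [hy, star_a_next_mul_re]
      exact mul_nonpos_of_nonneg_of_nonpos (hd0 i) (he3 i))
  have hgap := sub_nonneg.mpr (hopt.2 p hp)
  rw [objective_sub_objective_solStar, hpy, hpV, ← hV, Matrix.mul_smul, Matrix.trace_smul,
    smul_eq_mul, Complex.re_ofReal_mul] at hgap
  have hsum : ∑ i, 2 * (star ((Hᴴ *ᵥ v) i) * ((ε : ℂ) • y) i).re
      = -(ε * ∑ i, multiplier H v s i * (‖z i‖ ^ 2 + δ)) := by
    rw [Finset.mul_sum, ← Finset.sum_neg_distrib]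
    refine Finset.sum_congr rfl fun i _ => ?_
    have hw : star ((Hᴴ *ᵥ v) i) * (symbol (s i) * e i) = star (rotated H v s i) * e i := by
      rw [rotated, star_mul', star_star, xStar]
      ring
    rw [Pi.smul_apply, smul_eq_mul, mul_left_comm, Complex.re_ofReal_mul, hy, hw, multiplier, ← he4,
      Complex.star_def, Complex.mul_re, Complex.conj_re, Complex.conj_im, he1]
    ring
  have htr : (Matrix.diagonal (fun i => (multiplier H v s i : ℂ)) * V).trace.re
      = ∑ i, multiplier H v s i * (‖z i‖ ^ 2 + δ) := by
    rw [Matrix.trace, Complex.re_sum]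
    refine Finset.sum_congr rfl fun i _ => ?_
    rw [Matrix.diag_apply, Matrix.diagonal_mul, hdiag, ← Complex.ofReal_mul, Complex.ofReal_re]
  rw [hsum, sub_neg_eq_add, ← mul_add] at hgap
  rw [shifted, Matrix.add_mul, Matrix.trace_add, Complex.add_re, htr]
  exact nonneg_of_mul_nonneg_right hgap hε

theorem shifted_isHermitian {m n : ℕ} (H : Matrix (Fin m) (Fin n) ℂ) (lam : Fin n → ℝ) :
    (shifted H lam).IsHermitian := by
  refine (Matrix.isHermitian_conjTranspose_mul_self H).add
    (Matrix.isHermitian_diagonal_of_self_adjoint _ (funext fun i => ?_))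
  exact Complex.conj_ofReal _

/-- Let `δ → 0`. -/
theorem posSemidef_of_trace_mul_nonneg {n : ℕ} {S : Matrix (Fin n) (Fin n) ℂ}
    (hS : S.IsHermitian)
    (h : ∀ (z : Fin n → ℂ) (δ : ℝ), 0 < δ →
      0 ≤ (S * (Matrix.vecMulVec z (star z) + (δ : ℂ) • 1)).trace.re) : S.PosSemidef := by
  refine .of_dotProduct_mulVec_nonneg hS fun z => Complex.nonneg_iff.mpr ⟨?_, ?_⟩
  · have hlim : Filter.Tendsto (fun δ : ℝ => (star z ⬝ᵥ S *ᵥ z).re + δ * S.trace.re)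
        (nhdsWithin 0 (Set.Ioi 0)) (nhds (star z ⬝ᵥ S *ᵥ z).re) := by
      have hcont : Continuous fun δ : ℝ => (star z ⬝ᵥ S *ᵥ z).re + δ * S.trace.re := by fun_prop
      simpa using (hcont.tendsto 0).mono_left nhdsWithin_le_nhds
    refine ge_of_tendsto hlim ?_
    filter_upwards [self_mem_nhdsWithin] with δ hδ
    have := h z δ hδ
    rwa [Matrix.mul_add, Matrix.trace_add, trace_mul_vecMulVec_star, Matrix.mul_smul,
      Matrix.mul_one, Matrix.trace_smul, smul_eq_mul, Complex.add_re,
      Complex.re_ofReal_mul] at this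
  · exact (hS.im_star_dotProduct_mulVec_self z).symm

end CSDP2

theorem theorem4p2 {m n M : ℕ} (hM : 3 ≤ M) (H : Matrix (Fin m) (Fin n) ℂ) (v : Fin m → ℂ)
    (s : Fin n → Fin M) (r : Fin m → ℂ) (hr : r = H *ᵥ CSDP2.xStar s + v) :
    (CSDP2.IsOptimal M H r (CSDP2.solStar s) ↔
      ∃ (lam : Fin n → ℝ) (mu : Fin n → Fin M → ℝ),
        CSDP2.Decomposes H v s lam mu ∧ (CSDP2.shifted H lam).PosSemidef) ∧
    (∀ (lam : Fin n → ℝ) (mu : Fin n → Fin M → ℝ),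
      CSDP2.Decomposes H v s lam mu → (CSDP2.shifted H lam).PosDef →
        CSDP2.IsOptimal M H r (CSDP2.solStar s) ∧
          ∀ p, CSDP2.IsOptimal M H r p → p = CSDP2.solStar s) := by
  subst hr
  have hM' : (3 : ℝ) ≤ M := by exact_mod_cast hM
  have hpos : 0 < Real.pi / M := div_pos Real.pi_pos (by linarith)
  have hle : Real.pi / M ≤ Real.pi / 3 :=
    div_le_div_of_nonneg_left Real.pi_pos.le (by norm_num) hM'
  have hσ : 0 < Real.sin (Real.pi / M) :=
    Real.sin_pos_of_pos_of_lt_pi hpos (by linarith [Real.pi_pos])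
  have hc : 0 ≤ Real.cos (Real.pi / M) :=
    Real.cos_nonneg_of_neg_pi_div_two_le_of_le (by linarith [Real.pi_pos])
      (by linarith [Real.pi_pos])
  refine ⟨⟨fun hopt => ?_, fun ⟨lam, mu, hd, hS⟩ => CSDP2.isOptimal_of_decomposes hd hS⟩,
    fun lam mu hd hS => ⟨CSDP2.isOptimal_of_decomposes hd hS.posSemidef,
      fun p hp => CSDP2.eq_solStar_of_isOptimal hd hS hp⟩⟩
  obtain ⟨mu, hd⟩ := CSDP2.exists_decomposes (by omega) H v s hσ
  exact ⟨_, mu, hd, CSDP2.posSemidef_of_trace_mul_nonneg (CSDP2.shifted_isHermitian H _)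
    fun z δ hδ => hopt.trace_shifted_nonneg hσ hc z hδ⟩
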